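/- **Setting.** All mapping spaces below carry the $\Delta$-kelleyfication of the compact-open topology (the final topology with respect to all continuous maps from the spaces $\mathbb{R}^k$, $k\geq 0$), and products are products of $\Delta$-generated spaces (the $\Delta$-kelleyfication of the product topology). For $\ell_1,\ell_2>0$, let $\mathcal{M}(\ell_1,\ell_2)$ be the space of nondecreasing surjective maps $[0,\ell_1]\to[0,\ell_2]$. Let $K$ be a precubical set, with geometric realization $|K|=\varinjlim_{\square[n]\to K}[0,1]^n$, and let $\alpha,\beta\in K_0$. The *execution paths* of $K$ form the smallest set of continuous maps $[0,1]\to |K|$ which contains, for every $n$-cube $c$ of $K$, the images under the canonical map $[0,1]^n\to|K|$ of the paths $[0,1]\to[0,1]^n$ that are nondecreasing in each coordinate and go from a vertex $a\in\{0,1\}^n$ to a vertex $b\in\{0,1\}^n$ with $a<b$ (product order), and which is closed under precomposition with the elements of $\mathcal{M}(1,1)$ and under normalized composition of composable paths. (They are the execution paths of the colimit, in the category of multipointed $d$-spaces, of the tame cubes over the cubes of $K$.) For $\ell>0$, let $\overrightarrow{P}^{\ell}_{\alpha,\beta}(K)$ be the space of maps $[0,\ell]\to|K|$, $t\mapsto\gamma(t/\ell)$,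 where $\gamma$ is an execution path from $\alpha$ to $\beta$; its elements are the *tame $d$-paths of length $\ell$* from $\alpha$ to $\beta$. The $L_1$-arc length of a nondecreasing path in a cube $[0,1]^n$ is the $d_1$-distance $\sum_i|x_i-y_i|$ between its end points $x,y$, and the $L_1$-arc length of a finite concatenation of images in $|K|$ of such paths is the sum of the $L_1$-arc lengths of the pieces; it does not depend on the decomposition. Let $\widehat{L}(\gamma)(t)$ be the $L_1$-arc length of $\gamma$ between $\gamma(0)$ and $\gamma(t)$. For $n\geq 1$, let $\overrightarrow{P}^{\ell,n}_{\alpha,\beta}(K)$ be the space of the $\gamma\in\overrightarrow{P}^{\ell}_{\alpha,\beta}(K)$ with $\widehat{L}(\gamma)(\ell)=n$, and let $\overrightarrow{N}^{n}_{\alpha,\beta}(K)$ be the space of *natural* $d$-paths of length $n$: the $\gamma\in\overrightarrow{P}^{n}_{\alpha,\beta}(K)$ with $\widehat{L}(\gamma)(t)=t$ for all $t\in[0,n]$. **Theorem.** Let $K$ be a precubical set, let $\alpha,\beta\in K_0$ and let $\ell>0$. For every integer $n\geq1$, the map $\Phi^\ell:(\phi,\gamma)\mapsto\gamma\phi$ is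 a well-defined continuous map $$\mathcal{M}(\ell,n)\times\overrightarrow{P}^{n}_{\alpha,\beta}(K)\longrightarrow\overrightarrow{P}^{\ell}_{\alpha,\beta}(K),$$ and it induces a homeomorphism $$\mathcal{M}(\ell,n)\times\overrightarrow{N}^{n}_{\alpha,\beta}(K)\stackrel{\cong}\longrightarrow\overrightarrow{P}^{\ell,n}_{\alpha,\beta}(K).$$ Moreover, these maps assemble into a homeomorphism $$\Phi^\ell:\coprod_{n\geq1}\mathcal{M}(\ell,n)\times\overrightarrow{N}^{n}_{\alpha,\beta}(K)\stackrel{\cong}\longrightarrow\overrightarrow{P}^{\ell}_{\alpha,\beta}(K).$$ -/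

import Mathlib

open Set Topology
open scoped unitInterval

universe u

noncomputable section

/-! ### Topologies on mapping spaces -/

/-- The `Δ`-kelleyfication of a topological space `Y`: the same set, with the final topology with
respect to all continuous maps `ℝⁿ → Y`. -/
abbrev DeltaKelley (Y : Type*) [TopologicalSpace Y] : Type _ :=
  WithGeneratedByTopology (fun n : ℕ => Fin n → ℝ) Y

/-- The binary product of the category of `Δ`-generated spaces. -/
abbrev DeltaProd (Y Z : Type*) [TopologicalSpace Y] [TopologicalSpace Z] : Type _ :=
  DeltaKelley (Y × Z)

/-- The tautological bijection from a space to its `Δ`-kelleyfication. -/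
abbrev toDelta {Y : Type*} [TopologicalSpace Y] : Y ≃ DeltaKelley Y :=
  WithGeneratedByTopology.equiv.symm

/-- The tautological bijection from the `Δ`-kelleyfication of a space to the space. -/
abbrev ofDelta {Y : Type*} [TopologicalSpace Y] : DeltaKelley Y ≃ Y :=
  WithGeneratedByTopology.equiv

/-- The set of nondecreasing surjective continuous maps `[0, ℓ₁] → [0, ℓ₂]`,
with the compact-open topology. -/
abbrev Reparam (ℓ₁ ℓ₂ : ℝ) : Type :=
  {φ : C(Icc (0 : ℝ) ℓ₁, Icc (0 : ℝ) ℓ₂) // Monotone φ ∧ Function.Surjective φ}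

/-- The space `M(ℓ₁, ℓ₂)`. -/
abbrev MSpace (ℓ₁ ℓ₂ : ℝ) : Type := DeltaKelley (Reparam ℓ₁ ℓ₂)

/-- The map `μ_ℓ : [0, ℓ] → [0, 1]`, `t ↦ t / ℓ`. -/
def mu (ℓ : ℝ) : C(Icc (0 : ℝ) ℓ, I) where
  toFun t := ⟨t / ℓ, div_nonneg t.2.1 (t.2.1.trans t.2.2),
    div_le_one_of_le₀ t.2.2 (t.2.1.trans t.2.2)⟩
  continuous_toFun := by fun_prop

/-! ### Multipointed `d`-spaces -/

/-- A multipointed `d`-space: a space with a set of states and a set of execution paths, which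
start and end at states and are closed under reparametrization by nondecreasing surjective maps
and under normalized composition. -/
structure MultipointedDSpace where
  carrier : Type u
  [top : TopologicalSpace carrier]
  states : Set carrier
  execPaths : Set C(I, carrier)
  source_mem : ∀ γ ∈ execPaths, γ 0 ∈ states
  target_mem : ∀ γ ∈ execPaths, γ 1 ∈ states
  reparam_mem : ∀ γ ∈ execPaths, ∀ φ : Reparam 1 1, γ.comp φ.1 ∈ execPaths
  trans_mem : ∀ {x y z : carrier} (γ₁ : Path x y) (γ₂ : Path y z),
    γ₁.toContinuousMap ∈ execPaths → γ₂.toContinuousMap ∈ execPaths →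
      (γ₁.trans γ₂).toContinuousMap ∈ execPaths

attribute [instance] MultipointedDSpace.top

namespace MultipointedDSpace

/-- The execution paths from `x` to `y`. -/
def execPathsFromTo (X : MultipointedDSpace.{u}) (x y : X.carrier) : Set C(I, X.carrier) :=
  {γ | γ ∈ X.execPaths ∧ γ 0 = x ∧ γ 1 = y}

end MultipointedDSpace

theorem Reparam.map_zero (φ : Reparam 1 1) : φ.1 (0 : I) = (0 : I) := by
  obtain ⟨t, ht⟩ := φ.2.2 (0 : I)
  have h : φ.1 (0 : I) ≤ φ.1 t := φ.2.1 (show (0 : I) ≤ t from t.2.1)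
  exact le_antisymm (h.trans ht.le) (φ.1 (0 : I)).2.1

theorem Reparam.map_one (φ : Reparam 1 1) : φ.1 (1 : I) = (1 : I) := by
  obtain ⟨t, ht⟩ := φ.2.2 (1 : I)
  have h : φ.1 t ≤ φ.1 (1 : I) := φ.2.1 (show t ≤ (1 : I) from t.2.2)
  exact le_antisymm (φ.1 (1 : I)).2.2 (ht.ge.trans h)

theorem Path.monotone_trans {X : Type*} [TopologicalSpace X] [PartialOrder X] {x y z : X}
    (γ₁ : Path x y) (γ₂ : Path y z) (h₁ : Monotone γ₁) (h₂ : Monotone γ₂) :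
    Monotone (γ₁.trans γ₂) := by
  intro s t hst
  have hst' : (s : ℝ) ≤ t := hst
  rw [Path.trans_apply, Path.trans_apply]
  split_ifs with hs ht ht
  · exact h₁ (Subtype.mk_le_mk.2 (by linarith))
  · exact ((h₁ unitInterval.le_one').trans_eq γ₁.target).trans
      (γ₂.source.symm.trans_le (h₂ unitInterval.nonneg'))
  · exact absurd (hst'.trans ht) hs
  · exact h₂ (Subtype.mk_le_mk.2 (by linarith))

/-- The tame `n`-cube: the execution paths are the nondecreasing paths of `[0, 1]ⁿ` from a
vertex `a` to a vertex `b` with `a < b`. -/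
def tameCube (n : ℕ) : MultipointedDSpace.{0} where
  carrier := Fin n → I
  states := {x | ∀ i, x i = 0 ∨ x i = 1}
  execPaths := {γ | (∀ i, γ 0 i = 0 ∨ γ 0 i = 1) ∧ (∀ i, γ 1 i = 0 ∨ γ 1 i = 1) ∧
    γ 0 < γ 1 ∧ Monotone γ}
  source_mem _ h := h.1
  target_mem _ h := h.2.1
  reparam_mem := by
    rintro γ ⟨h0, h1, hlt, hm⟩ φ
    simp only [mem_ofPred_eq, ContinuousMap.comp_apply, φ.map_zero, φ.map_one]
    exact ⟨h0, h1, hlt, fun s t hst => hm (φ.2.1 hst)⟩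
  trans_mem := by
    rintro x y z γ₁ γ₂ ⟨h0, -, hlt, hm⟩ ⟨-, h1', hlt', hm'⟩
    simp only [Path.coe_toContinuousMap, Path.source, Path.target, mem_ofPred_eq] at *
    exact ⟨h0, h1', hlt.trans hlt', γ₁.monotone_trans γ₂ hm hm'⟩

/-! ### Precubical sets and their realizations -/

/-- A precubical set: sets `Kₙ` of `n`-cubes with face maps `∂ᵢᵃ` (`a = false` is the front face
`xᵢ = 0`, `a = true` is the back face `xᵢ = 1`), subject to `∂ᵢᵃ ∂ⱼᵇ = ∂ⱼ₋₁ᵇ ∂ᵢᵃ` for `i < j`. -/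
structure PrecubicalSet where
  cells : ℕ → Type u
  face : ∀ {n : ℕ}, Fin (n + 1) → Bool → cells (n + 1) → cells n
  face_face : ∀ {n : ℕ} (i j : Fin (n + 1)) (a b : Bool) (c : cells (n + 2)), i ≤ j →
    face i a (face j.succ b c) = face j b (face i.castSucc a c)

/-- The element of `{0, 1} ⊆ [0, 1]` given by a boolean. -/
def endpoint (a : Bool) : I := if a then 1 else 0

/-- The coface map `δᵢᵃ : [0, 1]ⁿ → [0, 1]ⁿ⁺¹`, which inserts the coordinate `a` at place `i`. -/
def coface {n : ℕ} (i : Fin (n + 1)) (a : Bool) (x : Fin n → I) : Fin (n + 1) → I :=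
  i.insertNth (α := fun _ => I) (endpoint a) x

/-- The distance `d₁` of `[0, 1]ⁿ`. -/
def dOne {n : ℕ} (x y : Fin n → I) : ℝ := ∑ i, |(x i : ℝ) - y i|

namespace PrecubicalSet

variable (K : PrecubicalSet.{u})

/-- The disjoint union of one topological cube for each cube of `K`. -/
abbrev CubeSum : Type u := Σ c : (Σ n : ℕ, K.cells n), Fin c.1 → I

/-- The identifications along the coface maps. -/
inductive Glue : K.CubeSum → K.CubeSum → Prop
  | mk {n : ℕ} (c : K.cells (n + 1)) (i : Fin (n + 1)) (a : Bool) (x : Fin n → I) :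
      Glue ⟨⟨n, K.face i a c⟩, x⟩ ⟨⟨n + 1, c⟩, coface i a x⟩

/-- The underlying space of the geometric realization: the colimit of the topological cubes
over the cubes of `K`, with the quotient topology. -/
def Geom : Type u := Quot K.Glue

instance : TopologicalSpace K.Geom := inferInstanceAs (TopologicalSpace (Quot K.Glue))

variable {K}

/-- The canonical map `[0, 1]ⁿ → |K|` of an `n`-cube `c`. -/
def cellMap {n : ℕ} (c : K.cells n) : C(Fin n → I, K.Geom) where
  toFun x := Quot.mk _ ⟨⟨n, c⟩, x⟩
  continuous_toFun := continuous_quot_mk.comp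
    (@continuous_sigmaMk _ (fun c : (Σ n : ℕ, K.cells n) => Fin c.1 → I) _ ⟨n, c⟩)

/-- The point of `|K|` given by a vertex of `K`. -/
def vertex (α : K.cells 0) : K.Geom := cellMap α Fin.elim0

theorem cellMap_coface {n : ℕ} (c : K.cells (n + 1)) (i : Fin (n + 1)) (a : Bool)
    (x : Fin n → I) : cellMap c (coface i a x) = cellMap (K.face i a c) x :=
  (Quot.sound (Glue.mk c i a x)).symm

theorem cellMap_mem_range_vertex : ∀ {n : ℕ} (c : K.cells n) (x : Fin n → I),
    (∀ i, x i = 0 ∨ x i = 1) → cellMap c x ∈ range (vertex (K := K))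
  | 0, c, x, _ => ⟨c, by rw [vertex, Subsingleton.elim x Fin.elim0]⟩
  | n + 1, c, x, hx => by
    obtain ⟨a, ha⟩ : ∃ a, endpoint a = x 0 := by
      rcases hx 0 with h | h
      · exact ⟨false, by simp [endpoint, h]⟩
      · exact ⟨true, by simp [endpoint, h]⟩
    have : x = coface 0 a (Fin.tail x) := by
      rw [coface, ha, Fin.insertNth_zero']
      exact (Fin.cons_self_tail x).symm
    rw [this, cellMap_coface]
    exact cellMap_mem_range_vertex _ _ fun i => hx i.succ

variable (K)

/-- The set of execution paths of the colimit of the tame cubes: the smallest set which contains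
the images of the execution paths of the tame cubes and which is closed under reparametrization
and normalized composition. -/
inductive IsExecPath : C(I, K.Geom) → Prop
  | cube {n : ℕ} (c : K.cells n) (γ : C(I, Fin n → I)) (h : γ ∈ (tameCube n).execPaths) :
      IsExecPath ((cellMap c).comp γ)
  | reparam (γ : C(I, K.Geom)) (φ : Reparam 1 1) (h : IsExecPath γ) : IsExecPath (γ.comp φ.1)
  | trans {x y z : K.Geom} (γ₁ : Path x y) (γ₂ : Path y z)
      (h₁ : IsExecPath γ₁.toContinuousMap) (h₂ : IsExecPath γ₂.toContinuousMap) :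
      IsExecPath (γ₁.trans γ₂).toContinuousMap

theorem IsExecPath.endpoints_mem {γ : C(I, K.Geom)} (h : K.IsExecPath γ) :
    γ 0 ∈ range (vertex (K := K)) ∧ γ 1 ∈ range (vertex (K := K)) := by
  induction h with
  | cube c γ h => exact ⟨cellMap_mem_range_vertex _ _ h.1, cellMap_mem_range_vertex _ _ h.2.1⟩
  | reparam γ φ _ ih =>
    simp only [ContinuousMap.comp_apply, φ.map_zero, φ.map_one]
    exact ih
  | trans γ₁ γ₂ _ _ ih₁ ih₂ =>
    simp only [Path.coe_toContinuousMap, Path.source, Path.target] at *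
    exact ⟨ih₁.1, ih₂.2⟩

/-- The tame realization `|K|ᵗ`: the colimit of the tame cubes over the cubes of `K` in the
category of multipointed `d`-spaces. Its underlying space is `K.Geom`, its states are the vertices
of `K`, and its execution paths form the final structure. -/
def tameRealization : MultipointedDSpace.{u} where
  carrier := K.Geom
  states := range (vertex (K := K))
  execPaths := {γ | K.IsExecPath γ}
  source_mem _ h := (h.endpoints_mem K).1
  target_mem _ h := (h.endpoints_mem K).2
  reparam_mem γ h φ := IsExecPath.reparam γ φ h
  trans_mem γ₁ γ₂ h₁ h₂ := IsExecPath.trans γ₁ γ₂ h₁ h₂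

/-! ### Arc length -/

variable {K}

/-- `HasArcLength p s t L`: on `[s, t]` the path `p` is a finite concatenation of nondecreasing
paths in cubes of `K`, and `L` is the sum of the `d₁`-distances between their end points. -/
inductive HasArcLength {ℓ : ℝ} (p : C(Icc (0 : ℝ) ℓ, K.Geom)) :
    Icc (0 : ℝ) ℓ → Icc (0 : ℝ) ℓ → ℝ → Prop
  | cube {n : ℕ} (c : K.cells n) (s t : Icc (0 : ℝ) ℓ) (hst : s ≤ t)
      (g : Icc (0 : ℝ) ℓ → Fin n → I) (hc : ContinuousOn g (Icc s t))
      (hm : MonotoneOn g (Icc s t)) (hp : ∀ v ∈ Icc s t, p v = cellMap c (g v)) :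
      HasArcLength p s t (dOne (g s) (g t))
  | concat {s t v : Icc (0 : ℝ) ℓ} {L L' : ℝ} (h : HasArcLength p s t L)
      (h' : HasArcLength p t v L') : HasArcLength p s v (L + L')

/-- The sum of the coordinates, modulo one, as a function on the realization. -/
def coordSum : K.Geom → AddCircle (1 : ℝ) :=
  Quot.lift (fun x => ((∑ i, (x.2 i : ℝ) : ℝ) : AddCircle (1 : ℝ))) (by
    rintro _ _ ⟨c, i, a, x⟩
    simp only [coface, Fin.sum_univ_succAbove _ i, Fin.insertNth_apply_same,
      Fin.insertNth_apply_succAbove, endpoint]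
    cases a <;> simp)

theorem HasArcLength.exists_lift {ℓ : ℝ} {p : C(Icc (0 : ℝ) ℓ, K.Geom)} {s t : Icc (0 : ℝ) ℓ}
    {L : ℝ} (h : HasArcLength p s t L) : s ≤ t ∧ ∃ F : Icc (0 : ℝ) ℓ → ℝ,
      ContinuousOn F (Icc s t) ∧ F s = 0 ∧ F t = L ∧
        ∀ v ∈ Icc s t, (F v : AddCircle (1 : ℝ)) = coordSum (p v) - coordSum (p s) := by
  induction h with
  | @cube n c s t hst g hc hm hp =>
    refine ⟨hst, fun v => ∑ i, (g v i : ℝ) - ∑ i, (g s i : ℝ), ?_, by simp, ?_, ?_⟩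
    · refine ContinuousOn.sub (continuousOn_finsetSum _ fun i _ => ?_) continuousOn_const
      exact continuous_subtype_val.comp_continuousOn ((continuous_apply i).comp_continuousOn hc)
    · change ∑ i, (g t i : ℝ) - ∑ i, (g s i : ℝ) = dOne (g s) (g t)
      rw [dOne, ← Finset.sum_sub_distrib]
      refine Finset.sum_congr rfl fun i _ => ?_
      have : (g s i : ℝ) ≤ g t i := hm (left_mem_Icc.2 hst) (right_mem_Icc.2 hst) hst i
      rw [abs_of_nonpos (by linarith)]
      ring
    · intro v hv
      rw [hp v hv, hp s (left_mem_Icc.2 hst), AddCircle.coe_sub]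
      rfl
  | @concat s t v L L' _ _ ih ih' =>
    obtain ⟨hst, F, hF, hF0, hF1, hFp⟩ := ih
    obtain ⟨htv, G, hG, hG0, hG1, hGp⟩ := ih'
    have e1 : EqOn (fun w => if w ≤ t then F w else L + G w) F (Icc s t) :=
      fun w hw => if_pos hw.2
    have e2 : EqOn (fun w => if w ≤ t then F w else L + G w) (fun w => L + G w) (Icc t v) := by
      intro w hw
      rcases hw.1.eq_or_lt with rfl | hlt
      · simp [hF1, hG0]
      · exact if_neg hlt.not_ge
    refine ⟨hst.trans htv, fun w => if w ≤ t then F w else L + G w, ?_, ?_, ?_, ?_⟩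
    · rw [← Icc_union_Icc_eq_Icc hst htv]
      exact ContinuousOn.union_of_isClosed (hF.congr e1)
        ((continuousOn_const.add hG).congr e2) isClosed_Icc isClosed_Icc
    · exact (e1 (left_mem_Icc.2 hst)).trans hF0
    · refine (e2 (right_mem_Icc.2 htv)).trans ?_
      simp [hG1]
    · intro w hw
      rcases le_total w t with h | h
      · rw [← hFp w ⟨hw.1, h⟩]
        exact congrArg _ (e1 ⟨hw.1, h⟩)
      · have : ((L + G w : ℝ) : AddCircle (1 : ℝ)) = coordSum (p w) - coordSum (p s) := by
          rw [AddCircle.coe_add, hGp w ⟨h, hw.2⟩, ← hF1, hFp t (right_mem_Icc.2 hst)]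
          abel
        rw [← this]
        exact congrArg _ (e2 ⟨h, hw.2⟩)

/-- The arc length does not depend on the decomposition. -/
theorem HasArcLength.unique {ℓ : ℝ} {p : C(Icc (0 : ℝ) ℓ, K.Geom)} {s t : Icc (0 : ℝ) ℓ}
    {L L' : ℝ} (h : HasArcLength p s t L) (h' : HasArcLength p s t L') : L = L' := by
  obtain ⟨hst, F, hF, hF0, hF1, hFp⟩ := h.exists_lift
  obtain ⟨-, G, hG, hG0, hG1, hGp⟩ := h'.exists_lift
  have hℓ : (0 : ℝ) ≤ ℓ := s.2.1.trans s.2.2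
  have hst' : (s : ℝ) ≤ t := hst
  have hmap : MapsTo (projIcc 0 ℓ hℓ) (Icc (s : ℝ) t) (Icc s t) := by
    intro w hw
    have : projIcc 0 ℓ hℓ w = ⟨w, s.2.1.trans hw.1, hw.2.trans t.2.2⟩ := projIcc_of_mem hℓ _
    rw [this]
    exact ⟨hw.1, hw.2⟩
  have hconst := (isPreconnected_Icc (a := (s : ℝ)) (b := t)).constant_of_mapsTo
    (T := range ((↑) : ℤ → ℝ)) (f := fun w => F (projIcc 0 ℓ hℓ w) - G (projIcc 0 ℓ hℓ w))
    ⟨Int.isClosedEmbedding_coe_real.isEmbedding.toHomeomorph.symm.isEmbedding.discreteTopology⟩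
    ((hF.comp continuous_projIcc.continuousOn hmap).sub
      (hG.comp continuous_projIcc.continuousOn hmap))
    (by
      intro w hw
      have h0 : ((F (projIcc 0 ℓ hℓ w) - G (projIcc 0 ℓ hℓ w) : ℝ) : AddCircle (1 : ℝ)) = 0 := by
        rw [AddCircle.coe_sub, hFp _ (hmap hw), hGp _ (hmap hw), sub_self]
      obtain ⟨k, hk⟩ := (AddCircle.coe_eq_zero_iff (1 : ℝ)).1 h0
      exact ⟨k, by simpa using hk⟩)
    (left_mem_Icc.2 hst') (right_mem_Icc.2 hst')
  simp only [projIcc_val, hF0, hG0, hF1, hG1] at hconst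
  linarith

/-- The function `L̂(p)`: the `L₁`-arc length of the `d`-path `p` between `p(0)` and `p(t)`
(zero if `p` is not a `d`-path there). -/
def arcLength {ℓ : ℝ} (p : C(Icc (0 : ℝ) ℓ, K.Geom)) (t : Icc (0 : ℝ) ℓ) : ℝ :=
  sSup {L | HasArcLength p ⟨0, le_rfl, t.2.1.trans t.2.2⟩ t L}

theorem HasArcLength.arcLength_eq {ℓ : ℝ} {p : C(Icc (0 : ℝ) ℓ, K.Geom)} {t : Icc (0 : ℝ) ℓ}
    {L : ℝ} (h : HasArcLength p ⟨0, le_rfl, t.2.1.trans t.2.2⟩ t L) : arcLength p t = L := by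
  have : {L | HasArcLength p ⟨0, le_rfl, t.2.1.trans t.2.2⟩ t L} = {L} :=
    eq_singleton_iff_unique_mem.2 ⟨h, fun _ h' => HasArcLength.unique h' h⟩
  rw [arcLength, this, csSup_singleton]

/-! ### Spaces of tame `d`-paths -/

variable (K)

/-- The set of tame `d`-paths of length `ℓ` from `α` to `β`. -/
def tamePaths (α β : K.cells 0) (ℓ : ℝ) : Set C(Icc (0 : ℝ) ℓ, K.Geom) :=
  {p | ∃ γ ∈ K.tameRealization.execPathsFromTo (vertex α) (vertex β), p = γ.comp (mu ℓ)}

/-- The set of tame `d`-paths of length `ℓ` from `α` to `β` which have `L₁`-arc length `n`. -/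
def tamePathsOfArcLength (α β : K.cells 0) {ℓ : ℝ} (hℓ : 0 < ℓ) (n : ℕ) :
    Set C(Icc (0 : ℝ) ℓ, K.Geom) :=
  {p | p ∈ K.tamePaths α β ℓ ∧ arcLength p ⟨ℓ, hℓ.le, le_rfl⟩ = n}

/-- The set of natural `d`-paths of length `n` from `α` to `β`. -/
def naturalPaths (α β : K.cells 0) (n : ℕ) : Set C(Icc (0 : ℝ) n, K.Geom) :=
  {p | p ∈ K.tamePaths α β n ∧ ∀ t, arcLength p t = t}

/-- The space of tame `d`-paths of length `ℓ` from `α` to `β`. -/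
abbrev PSpace (α β : K.cells 0) (ℓ : ℝ) : Type u := DeltaKelley (K.tamePaths α β ℓ)

/-- The space of tame `d`-paths of length `ℓ` and `L₁`-arc length `n` from `α` to `β`. -/
abbrev PLenSpace (α β : K.cells 0) {ℓ : ℝ} (hℓ : 0 < ℓ) (n : ℕ) : Type u :=
  DeltaKelley (K.tamePathsOfArcLength α β hℓ n)

/-- The space of natural `d`-paths of length `n` from `α` to `β`. -/
abbrev NSpace (α β : K.cells 0) (n : ℕ) : Type u := DeltaKelley (K.naturalPaths α β n)

end PrecubicalSet

end

noncomputable section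

/-! ### Reparametrizations -/

namespace Reparam

/-! A tame path `p` is determined by its arc length function and a natural path: arc length is a
reparametrization `φ` of `p`'s domain onto `[0, n]`, and `p = ν φ` with `ν` natural. Since `ν φ` has
arc length exactly `φ t` at time `t` (`arcLength_comp_reparam`), `φ` is recovered from `p`, and then
`ν` because `φ` is surjective.

Existence of `ν` goes by induction on execution paths (`IsExecPath.exists_natural`). In a cube, arc
length is the increase of the coordinate sum, an integer `m ≥ 1` between distinct comparable
vertices; a monotone path is constant wherever that sum is, so it factors through its normalized arc
length. Concatenations are handled by moving the junction from `1 / 2` to the time proportional to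
length (`IsExecPath.concat_natural`).

Continuity of the inverse rests on two facts. Arc length is jointly continuous in path and time,
being the lift through `ℝ → ℝ / ℤ` of the coordinate sum modulo one (`continuous_arcLength`). And
`(p, t) ↦ (p, φ_p t)` is a quotient map (`isQuotientMap_prodMk_of_compactSpace`), so `(p, s) ↦ ν_p
s` is continuous because it pulls back to evaluation `(p, t) ↦ p t`.

All this takes place in the compact-open topologies and passes to `Δ`-kelleyfications by
functoriality. The total arc length is a continuous integer, hence constant along every probe from
`ℝᵏ`, which gives the disjoint union. -/

theorem apply_left {a b : ℝ} (ha : 0 ≤ a) (hb : 0 ≤ b) (φ : Reparam a b) :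
    φ.1 ⟨0, le_rfl, ha⟩ = ⟨0, le_rfl, hb⟩ := by
  obtain ⟨t, ht⟩ := φ.2.2 ⟨0, le_rfl, hb⟩
  have h : φ.1 ⟨0, le_rfl, ha⟩ ≤ φ.1 t := φ.2.1 t.2.1
  exact le_antisymm (h.trans ht.le) (φ.1 ⟨0, le_rfl, ha⟩).2.1

theorem apply_right {a b : ℝ} (ha : 0 ≤ a) (hb : 0 ≤ b) (φ : Reparam a b) :
    φ.1 ⟨a, ha, le_rfl⟩ = ⟨b, hb, le_rfl⟩ := by
  obtain ⟨t, ht⟩ := φ.2.2 ⟨b, hb, le_rfl⟩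
  have h : φ.1 t ≤ φ.1 ⟨a, ha, le_rfl⟩ := φ.2.1 t.2.2
  exact le_antisymm (φ.1 ⟨a, ha, le_rfl⟩).2.2 (ht.ge.trans h)

/-- The reparametrization given by a nondecreasing continuous function with the right values at
the end points. -/
def ofFun {a b : ℝ} (ha : 0 ≤ a) (f : Icc (0 : ℝ) a → ℝ) (hc : Continuous f) (hm : Monotone f)
    (h0 : f ⟨0, le_rfl, ha⟩ = 0) (h1 : f ⟨a, ha, le_rfl⟩ = b) : Reparam a b :=
  ⟨⟨fun t => ⟨f t, h0.symm.le.trans (hm t.2.1), (hm t.2.2).trans h1.le⟩, by fun_prop⟩,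
    fun _ _ h => hm h, fun y => by
      have := Subtype.preconnectedSpace (isPreconnected_Icc (a := (0 : ℝ)) (b := a))
      obtain ⟨t, ht⟩ := mem_range_of_exists_le_of_exists_ge (f := f) hc
        ⟨⟨0, le_rfl, ha⟩, h0.le.trans y.2.1⟩ ⟨⟨a, ha, le_rfl⟩, y.2.2.trans h1.ge⟩
      exact ⟨t, Subtype.ext ht⟩⟩

/-- The composition of two reparametrizations. -/
def comp {a b c : ℝ} (ψ : Reparam b c) (φ : Reparam a b) : Reparam a c :=
  ⟨ψ.1.comp φ.1, ψ.2.1.comp φ.2.1, ψ.2.2.comp φ.2.2⟩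

/-- The linear reparametrization. -/
def linear {a b : ℝ} (ha : 0 < a) (hb : 0 ≤ b) : Reparam a b :=
  ofFun ha.le (fun t => b / a * t) (by fun_prop)
    (fun _ _ h => mul_le_mul_of_nonneg_left (show (_ : ℝ) ≤ _ from h) (div_nonneg hb ha.le))
    (by simp) (by field_simp)

theorem isQuotientMap {a b : ℝ} (φ : Reparam a b) : IsQuotientMap φ.1 :=
  IsQuotientMap.of_surjective_continuous φ.2.2 φ.1.continuous

/-- A continuous surjection from a compact interval onto a Hausdorff one is a quotient map, so a map
constant on the fibres of `φ` descends. -/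
theorem exists_factorization {a b : ℝ} {Y : Type*} [TopologicalSpace Y] (φ : Reparam a b)
    (g : C(Icc (0 : ℝ) a, Y)) (h : ∀ s t, φ.1 s = φ.1 t → g s = g t) :
    ∃ k : C(Icc (0 : ℝ) b, Y), g = k.comp φ.1 :=
  ⟨φ.isQuotientMap.lift (f := φ.1) g h, (φ.isQuotientMap.lift_comp (f := φ.1) g h).symm⟩

/-- The piecewise linear reparametrization of `[0, 1]` which sends `c` to `1 / 2`. -/
def breakAt (c : ℝ) (hc0 : 0 < c) (hc1 : c < 1) : Reparam 1 1 :=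
  -- The first summand climbs to `1 / 2` on `[0, c]` and then stays there; the second vanishes up to
  -- `c` and climbs to `1 / 2` on `[c, 1]`.
  ofFun zero_le_one (fun t => min (t / (2 * c)) (1 / 2) + max 0 ((t - c) / (2 * (1 - c))))
    (by fun_prop)
    (by
      intro s t hst
      have : (s : ℝ) ≤ t := hst
      have h1 : 0 < 1 - c := by linarith
      dsimp only
      gcongr)
    (by
      have h1 : 0 < 1 - c := by linarith
      have : (0 - c) / (2 * (1 - c)) ≤ 0 := 
        div_nonpos_of_nonpos_of_nonneg (by linarith) (by linarith)
      rw [max_eq_left this]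
      norm_num)
    (by
      have h1 : 0 < 1 - c := by linarith
      have h2 : (1 : ℝ) / 2 ≤ 1 / (2 * c) := by
        apply one_div_le_one_div_of_le <;> linarith
      have h3 : (1 - c) / (2 * (1 - c)) = 1 / 2 := by field_simp
      rw [min_eq_right h2, h3]
      norm_num)

/-- The reparametrization of `[0, 1]` which is `φ₁` from `[0, 1 / 2]` to `[0, c]` and `φ₂` from
`[1 / 2, 1]` to `[c, 1]`. -/
def glue (c : ℝ) (hc0 : 0 < c) (hc1 : c < 1) (φ₁ φ₂ : Reparam 1 1) : Reparam 1 1 :=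
  -- `projIcc` clamps the arguments: the second summand is zero on the first half, and the first
  -- summand is stuck at `c` on the second half.
  ofFun zero_le_one (fun t => c * φ₁.1 (projIcc 0 1 zero_le_one (2 * t)) +
      (1 - c) * φ₂.1 (projIcc 0 1 zero_le_one (2 * t - 1)))
    (by fun_prop)
    (by
      intro s t hst
      have : (s : ℝ) ≤ t := hst
      have h1 : 0 < 1 - c := by linarith
      have e1 : φ₁.1 (projIcc 0 1 zero_le_one (2 * s)) ≤ φ₁.1 (projIcc 0 1 zero_le_one (2 * t)) :=
        φ₁.2.1 (monotone_projIcc _ (by linarith))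
      have e2 : φ₂.1 (projIcc 0 1 zero_le_one (2 * s - 1)) ≤
          φ₂.1 (projIcc 0 1 zero_le_one (2 * t - 1)) :=
        φ₂.2.1 (monotone_projIcc _ (by linarith))
      exact add_le_add (mul_le_mul_of_nonneg_left e1 hc0.le) (mul_le_mul_of_nonneg_left e2 h1.le))
    (by
      rw [projIcc_of_le_left _ (by norm_num), projIcc_of_le_left _ (by norm_num)]
      have e1 := φ₁.apply_left zero_le_one zero_le_one
      have e2 := φ₂.apply_left zero_le_one zero_le_one
      rw [e1, e2]
      simp)
    (by
      rw [projIcc_of_right_le _ (by norm_num), projIcc_of_right_le _ (by norm_num)]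
      have e1 := φ₁.apply_right zero_le_one zero_le_one
      have e2 := φ₂.apply_right zero_le_one zero_le_one
      rw [e1, e2]
      simp)

end Reparam

namespace PrecubicalSet

variable {K : PrecubicalSet.{u}}

/-! ### Arc length -/

theorem dOne_eq_of_le {n : ℕ} {x y : Fin n → I} (h : x ≤ y) :
    dOne x y = ∑ i, (y i : ℝ) - ∑ i, (x i : ℝ) := by
  rw [dOne, ← Finset.sum_sub_distrib]
  refine Finset.sum_congr rfl fun i _ => ?_
  have : (x i : ℝ) ≤ y i := h i
  rw [abs_of_nonpos (by linarith)]
  ring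

theorem HasArcLength.le {ℓ : ℝ} {p : C(Icc (0 : ℝ) ℓ, K.Geom)} {s t : Icc (0 : ℝ) ℓ} {L : ℝ}
    (h : HasArcLength p s t L) : s ≤ t := h.exists_lift.1

/-- Monotone continuous changes of time preserve `d₁`-distances between corresponding end points.
For a concatenation, the intermediate value theorem pulls the junction back along `f`. Stating this
for a path `p'` that agrees with `p ∘ f` only on `[s', t']` lets it apply to the pieces of a
concatenated path. -/
theorem HasArcLength.transport {ℓ ℓ' : ℝ} {p : C(Icc (0 : ℝ) ℓ, K.Geom)}
    {p' : C(Icc (0 : ℝ) ℓ', K.Geom)} {s t : Icc (0 : ℝ) ℓ} {L : ℝ} (h : HasArcLength p s t L) :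
    ∀ {s' t' : Icc (0 : ℝ) ℓ'} (f : Icc (0 : ℝ) ℓ' → Icc (0 : ℝ) ℓ), s' ≤ t' →
      ContinuousOn f (Icc s' t') → MonotoneOn f (Icc s' t') →
      (∀ v ∈ Icc s' t', p' v = p (f v)) → f s' = s → f t' = t → HasArcLength p' s' t' L := by
  induction h with
  | @cube n c s t hst g hc hm hp =>
    rintro s' t' f hst' hfc hfm hpp rfl rfl
    have hmaps : MapsTo f (Icc s' t') (Icc (f s') (f t')) := fun v hv =>
      ⟨hfm (left_mem_Icc.2 hst') hv hv.1, hfm hv (right_mem_Icc.2 hst') hv.2⟩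
    exact HasArcLength.cube c s' t' hst' (g ∘ f) (hc.comp hfc hmaps)
      (hm.comp hfm hmaps) fun v hv => (hpp v hv).trans (hp _ (hmaps hv))
  | @concat s t v L L' h1 h2 ih1 ih2 =>
    rintro s' v' f hsv' hfc hfm hpp rfl rfl
    have hℓ : (0 : ℝ) ≤ ℓ' := s'.2.1.trans s'.2.2
    obtain ⟨t', ht', rfl⟩ : t ∈ f '' Icc s' v' := by
      have hmaps : ∀ w ∈ Icc (s' : ℝ) v', projIcc 0 ℓ' hℓ w ∈ Icc s' v' := by
        intro w hw
        rw [projIcc_of_mem hℓ ⟨s'.2.1.trans hw.1, hw.2.trans v'.2.2⟩]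
        exact hw
      have := intermediate_value_Icc (a := (s' : ℝ)) (b := v') hsv'
        (f := fun w => f (projIcc 0 ℓ' hℓ w)) (hfc.comp continuous_projIcc.continuousOn hmaps)
      simp only [projIcc_val] at this
      obtain ⟨w, hw, hwt⟩ := this ⟨h1.le, h2.le⟩
      exact ⟨_, hmaps w hw, hwt⟩
    have i1 : Icc s' t' ⊆ Icc s' v' := Icc_subset_Icc_right ht'.2
    have i2 : Icc t' v' ⊆ Icc s' v' := Icc_subset_Icc_left ht'.1
    exact (ih1 f ht'.1 (hfc.mono i1) (hfm.mono i1) (fun w hw => hpp w (i1 hw)) rfl rfl).concat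
      (ih2 f ht'.2 (hfc.mono i2) (hfm.mono i2) (fun w hw => hpp w (i2 hw)) rfl rfl)

theorem HasArcLength.comp_reparam {ℓ ℓ' : ℝ} {p : C(Icc (0 : ℝ) ℓ, K.Geom)} (φ : Reparam ℓ' ℓ)
    {s t : Icc (0 : ℝ) ℓ'} (hst : s ≤ t) {L : ℝ} (h : HasArcLength p (φ.1 s) (φ.1 t) L) :
    HasArcLength (p.comp φ.1) s t L :=
  h.transport φ.1 hst φ.1.continuous.continuousOn (φ.2.1.monotoneOn _) (fun _ _ => rfl) rfl rfl

/-! ### Natural parametrizations of execution paths -/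

/-- The coordinate sum along `g` is nondecreasing and grows by an integer `m`; divided by `m`, this
growth is the reparametrization. Equal sums at two times force equality of all coordinates by
monotonicity, hence `g` factors through it. -/
theorem exists_natural_of_tameCube {n : ℕ} {g : C(I, Fin n → I)}
    (hg : g ∈ (tameCube n).execPaths) :
    ∃ m : ℕ, 1 ≤ m ∧ ∃ (φ : Reparam 1 1) (k : C(I, Fin n → I)), g = k.comp φ.1 ∧
      k ∈ (tameCube n).execPaths ∧ ∀ t : I, dOne (k 0) (k t) = m * t := by
  obtain ⟨h0, h1, hlt, hm⟩ := hg
  have hmono : ∀ {s t : I}, s ≤ t → ∑ i, (g s i : ℝ) ≤ ∑ i, (g t i : ℝ) := fun h =>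
    Finset.sum_le_sum fun i _ => hm h i
  obtain ⟨m, hm1, hmA⟩ : ∃ m : ℕ, 1 ≤ m ∧ ∑ i, (g 1 i : ℝ) - ∑ i, (g 0 i : ℝ) = m := by
    have hint : ∀ x : Fin n → I, (∀ i, x i = 0 ∨ x i = 1) → ∃ k : ℤ, ∑ i, (x i : ℝ) = k := by
      intro x hx
      have : ∀ i, ∃ k : ℤ, (x i : ℝ) = k := fun i => by
        rcases hx i with h | h
        · exact ⟨0, by simp [h]⟩
        · exact ⟨1, by simp [h]⟩
      choose k hk using this
      exact ⟨∑ i, k i, by push_cast; exact Finset.sum_congr rfl fun i _ => hk i⟩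
    obtain ⟨k0, hk0⟩ := hint _ h0
    obtain ⟨k1, hk1⟩ := hint _ h1
    have hlt' : ∑ i, (g 0 i : ℝ) < ∑ i, (g 1 i : ℝ) := by
      obtain ⟨hle, i, hi⟩ := Pi.lt_def.1 hlt
      exact Finset.sum_lt_sum (fun j _ => hle j) ⟨i, Finset.mem_univ _, hi⟩
    rw [hk0, hk1, Int.cast_lt] at hlt'
    refine ⟨(k1 - k0).toNat, by omega, ?_⟩
    rw [hk0, hk1, ← Int.cast_natCast, Int.toNat_of_nonneg (by omega)]
    push_cast
    rfl
  have hmpos : (0 : ℝ) < m := by exact_mod_cast hm1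
  let φ : Reparam 1 1 := Reparam.ofFun zero_le_one
    (fun t => (∑ i, (g t i : ℝ) - ∑ i, (g 0 i : ℝ)) / m) (by fun_prop)
    (fun s t h => div_le_div_of_nonneg_right (sub_le_sub_right (hmono h) _) hmpos.le)
    (by
      change (∑ i, (g 0 i : ℝ) - ∑ i, (g 0 i : ℝ)) / m = 0
      simp)
    (by
      change (∑ i, (g 1 i : ℝ) - ∑ i, (g 0 i : ℝ)) / m = 1
      rw [hmA, div_self hmpos.ne'])
  have hφ : ∀ t, (φ.1 t : ℝ) * m = ∑ i, (g t i : ℝ) - ∑ i, (g 0 i : ℝ) := fun t =>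
    div_mul_cancel₀ _ hmpos.ne'
  have key : ∀ s t : I, s ≤ t → φ.1 s = φ.1 t → g s = g t := by
    intro s t hst h
    have h2 := (hφ s).symm.trans ((congrArg (fun x : I => (x : ℝ) * m) h).trans (hφ t))
    have h3 : ∑ i, (g s i : ℝ) = ∑ i, (g t i : ℝ) := by linarith
    rw [Finset.sum_eq_sum_iff_of_le (f := fun i => (g s i : ℝ)) (g := fun i => (g t i : ℝ))
      fun i _ => hm hst i] at h3
    exact funext fun i => Subtype.ext (h3 i (Finset.mem_univ _))
  obtain ⟨k, hgk⟩ := φ.exists_factorization g fun s t h => by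
    rcases le_total s t with hst | hst
    · exact key s t hst h
    · exact (key t s hst h.symm).symm
  have e0 : φ.1 (0 : I) = (0 : I) := φ.map_zero
  have e1 : φ.1 (1 : I) = (1 : I) := φ.map_one
  have hgk' : ∀ t, g t = k (φ.1 t) := fun t => DFunLike.congr_fun hgk t
  rw [hgk' 0, e0] at h0 hlt
  rw [hgk' 1, e1] at h1 hlt
  have hkm : Monotone k := by
    intro x y hxy
    obtain ⟨s, rfl⟩ := φ.2.2 x
    obtain ⟨t, rfl⟩ := φ.2.2 y
    -- If the chosen preimages are in the opposite order, monotonicity of `φ` forces the two images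
    -- to coincide.
    rcases le_total s t with hst | hst
    · rw [← hgk', ← hgk']
      exact hm hst
    · rw [le_antisymm hxy (φ.2.1 hst)]
  refine ⟨m, hm1, φ, k, hgk, ⟨h0, h1, hlt, hkm⟩, fun t => ?_⟩
  rw [dOne_eq_of_le (hkm t.2.1)]
  obtain ⟨s, rfl⟩ := φ.2.2 t
  have := hφ s
  rw [hgk' s, hgk' 0, e0] at this
  exact this.symm.trans (mul_comm _ _)

/-- Normalized composition gives speeds `2 m₁` and `2 m₂` on the two halves. The speed becomes the
constant `m₁ + m₂` once the junction sits at `c = m₁ / (m₁ + m₂)`: `breakAt` moves it there, and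
`glue` moves it back to `1 / 2` while inserting `φ₁` and `φ₂`. -/
theorem IsExecPath.concat_natural {x y z : K.Geom} (δ₁ : Path x y) (δ₂ : Path y z)
    (h₁ : K.IsExecPath δ₁.toContinuousMap) (h₂ : K.IsExecPath δ₂.toContinuousMap) {m₁ m₂ : ℕ}
    (hm₁ : 1 ≤ m₁) (hm₂ : 1 ≤ m₂)
    (hL₁ : ∀ t : I, HasArcLength (ℓ := 1) δ₁.toContinuousMap (0 : I) t (m₁ * t))
    (hL₂ : ∀ t : I, HasArcLength (ℓ := 1) δ₂.toContinuousMap (0 : I) t (m₂ * t))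
    (φ₁ φ₂ : Reparam 1 1) :
    ∃ (δ : C(I, K.Geom)) (φ : Reparam 1 1), K.IsExecPath δ ∧
      (∀ t : I, HasArcLength (ℓ := 1) δ (0 : I) t ((m₁ + m₂ : ℕ) * t)) ∧
      ∀ t : I, δ (φ.1 t) = if (t : ℝ) ≤ 1 / 2 then δ₁ (φ₁.1 (projIcc 0 1 zero_le_one (2 * t)))
        else δ₂ (φ₂.1 (projIcc 0 1 zero_le_one (2 * t - 1))) := by
  have hm₁' : (0 : ℝ) < m₁ := by exact_mod_cast hm₁
  have hm₂' : (0 : ℝ) < m₂ := by exact_mod_cast hm₂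
  obtain ⟨c, hc⟩ : ∃ c : ℝ, c = m₁ / (m₁ + m₂) := ⟨_, rfl⟩
  have hc0 : 0 < c := by rw [hc]; positivity
  have hc1 : c < 1 := by rw [hc, div_lt_one (by positivity)]; linarith
  have hc1' : 0 < 1 - c := by linarith
  have hcm₁ : (m₁ : ℝ) = (m₁ + m₂) * c := by rw [hc]; field_simp
  have hcm₂ : (m₂ : ℝ) = (m₁ + m₂) * (1 - c) := by linarith
  let τ := Reparam.breakAt c hc0 hc1
  let φ := Reparam.glue c hc0 hc1 φ₁ φ₂
  let δ : C(I, K.Geom) := (δ₁.trans δ₂).toContinuousMap.comp τ.1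
  have hτ : ∀ t : I, (τ.1 t : ℝ) = min (t / (2 * c)) (1 / 2) + max 0 ((t - c) / (2 * (1 - c))) :=
    fun t => rfl
  have hδ1 : ∀ t : I, (t : ℝ) ≤ c → δ t = δ₁ (projIcc 0 1 zero_le_one (t / c)) := by
    intro t ht
    have e : (τ.1 t : ℝ) = t / c / 2 := by
      rw [hτ, max_eq_left (div_nonpos_of_nonpos_of_nonneg (by linarith) (by linarith)),
        min_eq_left (by rw [div_le_div_iff₀ (by linarith) (by norm_num)]; linarith)]
      field_simp
      ring
    have hle : (t : ℝ) / c ≤ 1 := (div_le_one hc0).2 ht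
    change (δ₁.trans δ₂) (τ.1 t) = _
    have hle' : (τ.1 t : ℝ) ≤ 1 / 2 := by rw [e]; linarith
    rw [Path.trans_apply, dif_pos hle',
      projIcc_of_mem _ (⟨div_nonneg t.2.1 hc0.le, hle⟩ : (t : ℝ) / c ∈ Icc (0 : ℝ) 1)]
    exact congrArg δ₁ (Subtype.ext (by change 2 * (τ.1 t : ℝ) = _; rw [e]; ring))
  have hδ2 : ∀ t : I, c ≤ (t : ℝ) → δ t = δ₂ (projIcc 0 1 zero_le_one ((t - c) / (1 - c))) := by
    intro t ht
    rcases ht.eq_or_lt with h | h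
    -- At `t = c` the value comes from the first branch of the concatenation, and the two paths meet
    -- there.
    · rw [hδ1 t h.ge, ← h, div_self hc0.ne', sub_self, zero_div, projIcc_right, projIcc_left]
      exact δ₁.target.trans δ₂.source.symm
    have e : (τ.1 t : ℝ) = 1 / 2 + (t - c) / (1 - c) / 2 := by
      rw [hτ, max_eq_right (div_nonneg (by linarith) (by linarith)),
        min_eq_right (by rw [div_le_div_iff₀ (by norm_num) (by linarith)]; linarith)]
      field_simp
    have hpos : 0 < ((t : ℝ) - c) / (1 - c) := div_pos (by linarith) hc1'
    have hle : ((t : ℝ) - c) / (1 - c) ≤ 1 := (div_le_one hc1').2 (by linarith [t.2.2])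
    change (δ₁.trans δ₂) (τ.1 t) = _
    have hnle : ¬ (τ.1 t : ℝ) ≤ 1 / 2 := by rw [e]; linarith
    rw [Path.trans_apply, dif_neg hnle,
      projIcc_of_mem _ (⟨hpos.le, hle⟩ : ((t : ℝ) - c) / (1 - c) ∈ Icc (0 : ℝ) 1)]
    exact congrArg δ₂ (Subtype.ext (by change 2 * (τ.1 t : ℝ) - 1 = _; rw [e]; ring))
  refine ⟨δ, φ, (h₁.trans _ _ h₂).reparam _ τ, ?_, ?_⟩
  · have first : ∀ t : I, (t : ℝ) ≤ c → HasArcLength (ℓ := 1) δ (0 : I) t ((m₁ + m₂ : ℝ) * t) := by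
      intro t ht
      have hle : (t : ℝ) / c ≤ 1 := (div_le_one hc0).2 ht
      have h := hL₁ (projIcc 0 1 zero_le_one (t / c))
      have e : (m₁ : ℝ) * (projIcc 0 1 zero_le_one ((t : ℝ) / c) : I) = (m₁ + m₂) * t := by
        rw [projIcc_of_mem _ (⟨div_nonneg t.2.1 hc0.le, hle⟩ : (t : ℝ) / c ∈ Icc (0 : ℝ) 1)]
        change (m₁ : ℝ) * (t / c) = _
        rw [← mul_div_assoc, div_eq_iff hc0.ne']
        linear_combination (t : ℝ) * hcm₁
      rw [e] at h
      refine h.transport (fun v => projIcc 0 1 zero_le_one ((v : ℝ) / c)) t.2.1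
        (by fun_prop) ?_ (fun v hv => hδ1 v (le_trans (show (v : ℝ) ≤ t from hv.2) ht)) ?_ rfl
      · intro v _ w _ hvw
        exact monotone_projIcc _ (div_le_div_of_nonneg_right (show (v : ℝ) ≤ w from hvw) hc0.le)
      · exact Subtype.ext (by simp [projIcc])
    intro t
    push_cast
    rcases le_total (t : ℝ) c with ht | ht
    · exact first t ht
    let c' : I := ⟨c, hc0.le, hc1.le⟩
    have hle : ((t : ℝ) - c) / (1 - c) ≤ 1 := (div_le_one hc1').2 (by linarith [t.2.2])
    have h := hL₂ (projIcc 0 1 zero_le_one ((t - c) / (1 - c)))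
    have e : (m₂ : ℝ) * (projIcc 0 1 zero_le_one (((t : ℝ) - c) / (1 - c)) : I)
        = (m₁ + m₂) * t - (m₁ + m₂) * c := by
      rw [projIcc_of_mem _ (⟨div_nonneg (by linarith) hc1'.le, hle⟩ :
        ((t : ℝ) - c) / (1 - c) ∈ Icc (0 : ℝ) 1)]
      change (m₂ : ℝ) * ((t - c) / (1 - c)) = _
      rw [← mul_div_assoc, div_eq_iff hc1'.ne']
      linear_combination ((t : ℝ) - c) * hcm₂
    rw [e] at h
    have h2 : HasArcLength (ℓ := 1) δ c' t ((m₁ + m₂) * t - (m₁ + m₂) * c) := by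
      refine h.transport (fun v => projIcc 0 1 zero_le_one (((v : ℝ) - c) / (1 - c))) ht
        (by fun_prop) ?_ (fun v hv => hδ2 v hv.1) ?_ rfl
      · intro v _ w _ hvw
        exact monotone_projIcc _ (div_le_div_of_nonneg_right
          (sub_le_sub_right (show (v : ℝ) ≤ w from hvw) c) hc1'.le)
      · exact Subtype.ext (by simp [projIcc, c'])
    have := (first c' le_rfl).concat h2
    rwa [add_sub_cancel] at this
  · intro t
    have hφ : (φ.1 t : ℝ) = c * φ₁.1 (projIcc 0 1 zero_le_one (2 * t)) +
      (1 - c) * φ₂.1 (projIcc 0 1 zero_le_one (2 * t - 1)) := rfl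
    split_ifs with ht
    · have e0 : (φ₂.1 (0 : I) : ℝ) = 0 := congrArg Subtype.val φ₂.map_zero
      have e : (φ.1 t : ℝ) = c * φ₁.1 (projIcc 0 1 zero_le_one (2 * t)) := by
        rw [hφ, projIcc_of_le_left (x := 2 * (t : ℝ) - 1) _ (by linarith)]
        change _ + (1 - c) * (φ₂.1 (0 : I) : ℝ) = _
        rw [e0, mul_zero, add_zero]
      rw [hδ1 _ (by
        rw [e]
        exact mul_le_of_le_one_right hc0.le (φ₁.1 _).2.2), e, mul_div_cancel_left₀ _ hc0.ne',
        projIcc_val]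
    · push Not at ht
      have e1 : (φ₁.1 (1 : I) : ℝ) = 1 := congrArg Subtype.val φ₁.map_one
      have e : (φ.1 t : ℝ) = c + (1 - c) * φ₂.1 (projIcc 0 1 zero_le_one (2 * t - 1)) := by
        rw [hφ, projIcc_of_right_le (x := 2 * (t : ℝ)) _ (by linarith)]
        change c * (φ₁.1 (1 : I) : ℝ) + _ = _
        rw [e1, mul_one]
      rw [hδ2 _ (by
        rw [e]
        exact le_add_of_nonneg_right (mul_nonneg hc1'.le (φ₂.1 _).2.1)), e, add_sub_cancel_left,
        mul_div_cancel_left₀ _ hc1'.ne', projIcc_val]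

/-- An execution path is a reparametrization of one with constant speed. -/
theorem IsExecPath.exists_natural {γ : C(I, K.Geom)} (h : K.IsExecPath γ) :
    ∃ m : ℕ, 1 ≤ m ∧ ∃ (δ : C(I, K.Geom)) (φ : Reparam 1 1), K.IsExecPath δ ∧
      (∀ t : I, HasArcLength (ℓ := 1) δ (0 : I) t (m * t)) ∧ γ = δ.comp φ.1 := by
  induction h with
  | cube c γ h =>
    obtain ⟨m, hm, φ, k, rfl, hk, hL⟩ := exists_natural_of_tameCube h
    refine ⟨m, hm, (cellMap c).comp k, φ, .cube c k hk, fun t => ?_, rfl⟩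
    rw [← hL t]
    exact .cube c (0 : I) t t.2.1 k k.continuous.continuousOn (hk.2.2.2.monotoneOn _)
      fun _ _ => rfl
  | reparam γ ψ _ ih =>
    obtain ⟨m, hm, δ, φ, hδ, hL, rfl⟩ := ih
    exact ⟨m, hm, δ, φ.comp ψ, hδ, hL, rfl⟩
  | @trans x y z γ₁ γ₂ _ _ ih₁ ih₂ =>
    obtain ⟨m₁, hm₁, δ₁, φ₁, hδ₁, hL₁, e₁⟩ := ih₁
    obtain ⟨m₂, hm₂, δ₂, φ₂, hδ₂, hL₂, e₂⟩ := ih₂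
    have e₁' : ∀ t, γ₁ t = δ₁ (φ₁.1 t) := fun t => DFunLike.congr_fun e₁ t
    have e₂' : ∀ t, γ₂ t = δ₂ (φ₂.1 t) := fun t => DFunLike.congr_fun e₂ t
    let δ₁' : Path x y := ⟨δ₁, by rw [← γ₁.source, e₁' 0, φ₁.map_zero]; rfl,
      by rw [← γ₁.target, e₁' 1, φ₁.map_one]; rfl⟩
    let δ₂' : Path y z := ⟨δ₂, by rw [← γ₂.source, e₂' 0, φ₂.map_zero]; rfl,
      by rw [← γ₂.target, e₂' 1, φ₂.map_one]; rfl⟩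
    obtain ⟨δ, φ, hδ, hL, e⟩ := IsExecPath.concat_natural δ₁' δ₂' hδ₁ hδ₂ hm₁ hm₂ hL₁ hL₂ φ₁ φ₂
    refine ⟨m₁ + m₂, by omega, δ, φ, hδ, hL, ContinuousMap.ext fun t => ?_⟩
    refine Eq.trans ?_ (e t).symm
    rw [Path.coe_toContinuousMap, Path.trans_apply]
    split_ifs with ht
    · rw [e₁', projIcc_of_mem zero_le_one (⟨by linarith [t.2.1], by linarith⟩ :
        2 * (t : ℝ) ∈ Icc (0 : ℝ) 1)]
      rfl
    · rw [e₂', projIcc_of_mem zero_le_one (⟨by linarith, by linarith [t.2.2]⟩ :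
        2 * (t : ℝ) - 1 ∈ Icc (0 : ℝ) 1)]
      rfl

/-! ### Natural parametrizations of tame paths -/

/-- Linear rescaling of the constant speed parametrization on `[0, 1]` to `[0, m]` makes the speed
equal to one. -/
theorem exists_natural_of_mem_tamePaths {α β : K.cells 0} {ℓ : ℝ} (hℓ : 0 < ℓ)
    {p : C(Icc (0 : ℝ) ℓ, K.Geom)} (hp : p ∈ K.tamePaths α β ℓ) :
    ∃ m : ℕ, 1 ≤ m ∧ ∃ (ν : C(Icc (0 : ℝ) m, K.Geom)) (φ : Reparam ℓ m),
      ν ∈ K.tamePaths α β m ∧ (∀ t, HasArcLength ν ⟨0, le_rfl, t.2.1.trans t.2.2⟩ t t) ∧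
        p = ν.comp φ.1 := by
  obtain ⟨γ, ⟨hγ, hα, hβ⟩, rfl⟩ := hp
  obtain ⟨m, hm, δ, φ, hδ, hL, rfl⟩ := IsExecPath.exists_natural hγ
  have hm' : (0 : ℝ) < m := by exact_mod_cast hm
  refine ⟨m, hm, δ.comp (mu m), ((Reparam.linear zero_lt_one hm'.le).comp φ).comp
    (Reparam.linear hℓ zero_le_one), ⟨δ, ⟨hδ, ?_, ?_⟩, rfl⟩, fun t => ?_, ?_⟩
  · exact (congrArg δ φ.map_zero.symm).trans hα
  · exact (congrArg δ φ.map_one.symm).trans hβ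
  · have h := hL (mu m t)
    have e : (m : ℝ) * (mu m t : ℝ) = t := mul_div_cancel₀ _ hm'.ne'
    rw [e] at h
    refine h.transport (mu m) t.2.1 (mu m).continuous.continuousOn ?_ (fun _ _ => rfl) ?_ rfl
    · intro s _ t _ hst
      exact div_le_div_of_nonneg_right (show (s : ℝ) ≤ t from hst) hm'.le
    · exact Subtype.ext (zero_div _)
  · ext t
    refine congrArg δ ?_
    have e : mu ℓ t = (Reparam.linear hℓ zero_le_one).1 t :=
      Subtype.ext (by change (t : ℝ) / ℓ = 1 / ℓ * t; ring)
    refine (congrArg φ.1 e).trans (Subtype.ext ?_)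
    change _ = (m : ℝ) / 1 * (φ.1 ((Reparam.linear hℓ zero_le_one).1 t) : ℝ) / m
    field_simp

/-- On tame paths the supremum defining `arcLength` is not a default value: it is attained by an
actual decomposition. -/
theorem hasArcLength_of_mem_tamePaths {α β : K.cells 0} {ℓ : ℝ} (hℓ : 0 < ℓ)
    {p : C(Icc (0 : ℝ) ℓ, K.Geom)} (hp : p ∈ K.tamePaths α β ℓ) (t : Icc (0 : ℝ) ℓ) :
    HasArcLength p ⟨0, le_rfl, t.2.1.trans t.2.2⟩ t (arcLength p t) := by
  obtain ⟨m, -, ν, φ, -, hL, rfl⟩ := exists_natural_of_mem_tamePaths hℓ hp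
  have h : HasArcLength (ν.comp φ.1) ⟨0, le_rfl, t.2.1.trans t.2.2⟩ t (φ.1 t) := by
    refine HasArcLength.comp_reparam φ t.2.1 ?_
    rw [φ.apply_left hℓ.le m.cast_nonneg]
    exact hL _
  rwa [h.arcLength_eq]

theorem arcLength_comp_reparam {α β : K.cells 0} {n : ℕ} (hn : 1 ≤ n) {ℓ : ℝ} (hℓ : 0 < ℓ)
    {ν : C(Icc (0 : ℝ) n, K.Geom)} (hν : ν ∈ K.naturalPaths α β n) (φ : Reparam ℓ n)
    (t : Icc (0 : ℝ) ℓ) : arcLength (ν.comp φ.1) t = φ.1 t := by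
  refine HasArcLength.arcLength_eq (HasArcLength.comp_reparam φ t.2.1 ?_)
  rw [φ.apply_left hℓ.le n.cast_nonneg]
  have := hasArcLength_of_mem_tamePaths (by exact_mod_cast hn) hν.1 (φ.1 t)
  rwa [hν.2] at this

theorem exists_eq_comp_reparam {α β : K.cells 0} {ℓ : ℝ} (hℓ : 0 < ℓ)
    {p : C(Icc (0 : ℝ) ℓ, K.Geom)} (hp : p ∈ K.tamePaths α β ℓ) :
    ∃ m : ℕ, 1 ≤ m ∧ ∃ ν ∈ K.naturalPaths α β m, ∃ φ : Reparam ℓ m, p = ν.comp φ.1 := by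
  obtain ⟨m, hm, ν, φ, hν, hL, h⟩ := exists_natural_of_mem_tamePaths hℓ hp
  exact ⟨m, hm, ν, ⟨hν, fun t => (hL t).arcLength_eq⟩, φ, h⟩

/-- Conjugating `φ` by linear rescalings gives an element of `M(1, 1)`, under which execution paths
are closed. -/
theorem comp_reparam_mem_tamePaths {α β : K.cells 0} {ℓ ℓ' : ℝ} (hℓ : 0 < ℓ) (hℓ' : 0 < ℓ')
    {p : C(Icc (0 : ℝ) ℓ', K.Geom)} (hp : p ∈ K.tamePaths α β ℓ') (φ : Reparam ℓ ℓ') :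
    p.comp φ.1 ∈ K.tamePaths α β ℓ := by
  obtain ⟨γ, ⟨hγ, hα, hβ⟩, rfl⟩ := hp
  let ψ : Reparam 1 1 := ((Reparam.linear hℓ' zero_le_one).comp φ).comp
    (Reparam.linear zero_lt_one hℓ.le)
  refine ⟨γ.comp ψ.1, ⟨hγ.reparam _ ψ, (congrArg γ ψ.map_zero).trans hα,
    (congrArg γ ψ.map_one).trans hβ⟩, ?_⟩
  ext t
  refine congrArg γ (Subtype.ext ?_)
  have e : (Reparam.linear zero_lt_one hℓ.le).1 (mu ℓ t) = t :=
    Subtype.ext (by change ℓ / 1 * ((t : ℝ) / ℓ) = t; field_simp)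
  change (φ.1 t : ℝ) / ℓ' = 1 / ℓ' * (φ.1 ((Reparam.linear zero_lt_one hℓ.le).1 (mu ℓ t)) : ℝ)
  rw [e]
  ring

/-! ### Joint continuity of the arc length -/

theorem continuous_coordSum : Continuous (coordSum (K := K)) := by
  refine continuous_quot_lift _ (continuous_sigma fun c => ?_)
  have h : Continuous fun x : Fin c.1 → I => ∑ i, (x i : ℝ) := by fun_prop
  exact (AddCircle.continuous_mk' 1).comp h

/-- Arc length lifts the variation of `coordSum`, which is jointly continuous with values in `ℝ /
ℤ`. A lift through a covering that is continuous in time for each fixed path, and continuous in the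
path at time zero, is jointly continuous. -/
theorem continuous_arcLength {α β : K.cells 0} {ℓ : ℝ} (hℓ : 0 < ℓ) :
    Continuous fun x : K.tamePaths α β ℓ × Icc (0 : ℝ) ℓ => arcLength x.1.1 x.2 := by
  have h0 : ∀ p : K.tamePaths α β ℓ, arcLength p.1 ⟨0, le_rfl, hℓ.le⟩ = 0 := fun p => by
    obtain ⟨m, hm, ν, hν, φ, h⟩ := exists_eq_comp_reparam hℓ p.2
    rw [h, arcLength_comp_reparam hm hℓ hν, φ.apply_left hℓ.le m.cast_nonneg]
  -- The lifting criterion concerns homotopies over the unit interval; time is rescaled to `[0, 1]`,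
  -- and back by `mu ℓ` at the end.
  let lin : Reparam 1 ℓ := Reparam.linear zero_lt_one hℓ.le
  have hlin0 : lin.1 (0 : I) = ⟨0, le_rfl, hℓ.le⟩ := lin.apply_left zero_le_one hℓ.le
  let f : C(I × K.tamePaths α β ℓ, AddCircle (1 : ℝ)) :=
    ⟨fun x => coordSum (x.2.1 (lin.1 x.1)) - coordSum (x.2.1 ⟨0, le_rfl, hℓ.le⟩), by
      have := continuous_coordSum (K := K)
      have := lin.1.continuous
      fun_prop⟩
  have hcov := AddCircle.isCoveringMap_coe (1 : ℝ)
  have key : Continuous fun x : I × K.tamePaths α β ℓ => arcLength x.2.1 (lin.1 x.1) := by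
    refine hcov.isLocalHomeomorph.continuous_lift hcov.isSeparatedMap f (funext fun x => ?_) ?_ ?_
    · obtain ⟨hle, F, -, -, hF, h⟩ :=
        (hasArcLength_of_mem_tamePaths hℓ x.2.2 (lin.1 x.1)).exists_lift
      rw [Function.comp_apply, ← hF]
      exact h _ (right_mem_Icc.2 hle)
    · simp only [hlin0, h0]
      exact continuous_const
    · intro p
      obtain ⟨m, hm, ν, hν, φ, h⟩ := exists_eq_comp_reparam hℓ p.2
      simp only [h, arcLength_comp_reparam hm hℓ hν]
      exact continuous_subtype_val.comp (φ.1.continuous.comp lin.1.continuous)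
  have e : ∀ t : Icc (0 : ℝ) ℓ, lin.1 (mu ℓ t) = t := fun t =>
    Subtype.ext (by change ℓ / 1 * ((t : ℝ) / ℓ) = t; field_simp)
  have := key.comp (((mu ℓ).continuous.comp continuous_snd).prodMk
    (continuous_fst (X := K.tamePaths α β ℓ)))
  simpa only [Function.comp_def, e] using this

/-! ### The homeomorphism for the compact-open topologies -/

theorem exists_natCast_eq_arcLength {α β : K.cells 0} {ℓ : ℝ} (hℓ : 0 < ℓ)
    (p : K.tamePaths α β ℓ) : ∃ n : {n : ℕ // 1 ≤ n}, arcLength p.1 ⟨ℓ, hℓ.le, le_rfl⟩ = n.1 := by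
  obtain ⟨m, hm, ν, hν, φ, h⟩ := exists_eq_comp_reparam hℓ p.2
  refine ⟨⟨m, hm⟩, ?_⟩
  rw [h, arcLength_comp_reparam hm hℓ hν, φ.apply_right hℓ.le m.cast_nonneg]

/-- The bijection `(φ, γ) ↦ γ φ`. -/
def naturalEquiv (α β : K.cells 0) {ℓ : ℝ} (hℓ : 0 < ℓ) {n : ℕ} (hn : 1 ≤ n) :
    Reparam ℓ n × K.naturalPaths α β n ≃ K.tamePathsOfArcLength α β hℓ n :=
  Equiv.ofBijective
    (fun x => ⟨x.2.1.comp x.1.1, comp_reparam_mem_tamePaths hℓ (by exact_mod_cast hn) x.2.2.1 x.1,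
      by rw [arcLength_comp_reparam hn hℓ x.2.2, x.1.apply_right hℓ.le n.cast_nonneg]⟩) <| by
    constructor
    · rintro ⟨φ, ν, hν⟩ ⟨φ', ν', hν'⟩ h
      have h' : ν.comp φ.1 = ν'.comp φ'.1 := congrArg Subtype.val h
      -- The reparametrization is the arc length of the composite, so it can be read off from it.
      obtain rfl : φ = φ' := Subtype.ext <| ContinuousMap.ext fun t => Subtype.ext <| by
        rw [← arcLength_comp_reparam hn hℓ hν, h', arcLength_comp_reparam hn hℓ hν']
      obtain rfl : ν = ν' := ContinuousMap.ext fun s => by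
        obtain ⟨t, rfl⟩ := φ.2.2 s
        exact DFunLike.congr_fun h' t
      rfl
    · rintro ⟨p, hp, hpn⟩
      obtain ⟨m, hm, ν, hν, φ, rfl⟩ := exists_eq_comp_reparam hℓ hp
      rw [arcLength_comp_reparam hm hℓ hν, φ.apply_right hℓ.le m.cast_nonneg] at hpn
      obtain rfl : m = n := Nat.cast_injective hpn
      exact ⟨⟨φ, ν, hν⟩, rfl⟩

/-- The map is proper: if the image of an ultrafilter converges, compactness of `Y` gives the
ultrafilter a limit, and its image is the given one since `Z` is Hausdorff. A closed continuous
surjection is a quotient map. No local compactness of `X` is needed, and the surjection `Y → Z` may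
vary with `x`. -/
theorem isQuotientMap_prodMk_of_compactSpace {X Y Z : Type*} [TopologicalSpace X]
    [TopologicalSpace Y] [TopologicalSpace Z] [CompactSpace Y] [T2Space Z] {f : X × Y → Z}
    (hf : Continuous f) (hs : ∀ x, Function.Surjective fun y => f (x, y)) :
    IsQuotientMap fun x : X × Y => (x.1, f x) := by
  have hc : Continuous fun x : X × Y => (x.1, f x) := by fun_prop
  refine IsClosedMap.isQuotientMap (IsProperMap.isClosedMap ?_) hc fun ⟨x, z⟩ => ?_
  · refine isProperMap_iff_ultrafilter.2 ⟨hc, fun 𝒰 z h => ?_⟩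
    have h1 : Filter.Tendsto Prod.fst (𝒰 : Filter (X × Y)) (𝓝 z.1) :=
      (continuous_fst.tendsto z).comp h
    have h2 : Filter.Tendsto f (𝒰 : Filter (X × Y)) (𝓝 z.2) := (continuous_snd.tendsto z).comp h
    obtain ⟨⟨x, y⟩, hx, hxy⟩ := (isProperMap_iff_ultrafilter.1
      (isProperMap_fst_of_compactSpace (X := X) (Y := Y))).2 h1
    obtain rfl : x = z.1 := hx
    exact ⟨(z.1, y), Prod.ext rfl (tendsto_nhds_unique ((hf.tendsto _).mono_left hxy) h2), hxy⟩
  · obtain ⟨y, rfl⟩ := hs x z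
    exact ⟨(x, y), rfl⟩

/-- The homeomorphism `(φ, γ) ↦ γ φ` for the compact-open topologies. -/
def naturalHomeomorph (α β : K.cells 0) {ℓ : ℝ} (hℓ : 0 < ℓ) {n : ℕ} (hn : 1 ≤ n) :
    Reparam ℓ n × K.naturalPaths α β n ≃ₜ K.tamePathsOfArcLength α β hℓ n where
  toEquiv := naturalEquiv α β hℓ hn
  continuous_toFun := by
    refine Continuous.subtype_mk ?_ _
    exact ContinuousMap.continuous_comp'.comp
      ((continuous_subtype_val.comp continuous_fst).prodMk
        (continuous_subtype_val.comp continuous_snd))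
  continuous_invFun := by
    have hcomp : ∀ p, p.1 = ((naturalEquiv α β hℓ hn).symm p).2.1.comp
        ((naturalEquiv α β hℓ hn).symm p).1.1 := fun p =>
      congrArg Subtype.val ((naturalEquiv α β hℓ hn).apply_symm_apply p).symm
    have hφ : ∀ p t, (((naturalEquiv α β hℓ hn).symm p).1.1 t : ℝ) = arcLength p.1 t := by
      intro p t
      rw [← arcLength_comp_reparam hn hℓ ((naturalEquiv α β hℓ hn).symm p).2.2, ← hcomp]
    have hA : Continuous fun x : K.tamePathsOfArcLength α β hℓ n × Icc (0 : ℝ) ℓ =>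
        ((naturalEquiv α β hℓ hn).symm x.1).1.1 x.2 := by
      refine continuous_induced_rng.2 ?_
      have := (continuous_arcLength (α := α) (β := β) hℓ).comp
        (Continuous.prodMap (continuous_inclusion
          (fun _ h => h.1 : K.tamePathsOfArcLength α β hℓ n ⊆ K.tamePaths α β ℓ)) continuous_id)
      exact this.congr fun x => (hφ x.1 x.2).symm
    refine Continuous.prodMk (Continuous.subtype_mk
      (ContinuousMap.continuous_of_continuous_uncurry _ hA) _) (Continuous.subtype_mk
      (ContinuousMap.continuous_of_continuous_uncurry _ ?_) _)
    -- Continuity of `(p, s) ↦ ν_p s` is tested after substituting `s = φ_p t`, where it becomes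
    -- evaluation of `p` at `t`.
    refine (isQuotientMap_prodMk_of_compactSpace hA fun p =>
      ((naturalEquiv α β hℓ hn).symm p).1.2.2).continuous_iff.2 ?_
    have : Continuous fun x : K.tamePathsOfArcLength α β hℓ n × Icc (0 : ℝ) ℓ => x.1.1 x.2 := by
      fun_prop
    exact this.congr fun x => DFunLike.congr_fun (hcomp x.1) x.2

/-- The decomposition of the set of tame paths by arc length. -/
def sigmaArcLengthEquiv (α β : K.cells 0) {ℓ : ℝ} (hℓ : 0 < ℓ) :
    (Σ n : {n : ℕ // 1 ≤ n}, K.tamePathsOfArcLength α β hℓ n) ≃ K.tamePaths α β ℓ where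
  toFun x := ⟨x.2.1, x.2.2.1⟩
  invFun p := ⟨(exists_natCast_eq_arcLength hℓ p).choose, p.1, p.2,
    (exists_natCast_eq_arcLength hℓ p).choose_spec⟩
  left_inv x := by
    have inj : ∀ x y : Σ n : {n : ℕ // 1 ≤ n}, K.tamePathsOfArcLength α β hℓ n,
        x.2.1 = y.2.1 → x = y := by
      rintro ⟨n, p, hp, hn⟩ ⟨m, q, hq, hm⟩ h
      obtain rfl : p = q := h
      obtain rfl : n = m := Subtype.ext (Nat.cast_injective (hn.symm.trans hm))
      rfl
    exact inj _ _ rfl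
  right_inv _ := rfl

theorem continuous_sigmaArcLengthEquiv_symm_fst (α β : K.cells 0) {ℓ : ℝ} (hℓ : 0 < ℓ) :
    Continuous fun p => ((sigmaArcLengthEquiv α β hℓ).symm p).1 := by
  refine continuous_induced_rng.2 (Nat.isClosedEmbedding_coe_real.isInducing.continuous_iff.2 ?_)
  have := (continuous_arcLength (α := α) (β := β) hℓ).comp
    (Continuous.prodMk_left (⟨ℓ, hℓ.le, le_rfl⟩ : Icc (0 : ℝ) ℓ))
  exact this.congr fun p => ((sigmaArcLengthEquiv α β hℓ).symm p).2.2.2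

end PrecubicalSet

/-! ### `Δ`-kelleyfications -/

/-- A homeomorphism induces a homeomorphism of the `Δ`-kelleyfications. -/
def Homeomorph.deltaKelley {X Y : Type*} [TopologicalSpace X] [TopologicalSpace Y] (e : X ≃ₜ Y) :
    DeltaKelley X ≃ₜ DeltaKelley Y where
  toEquiv := (ofDelta.trans e.toEquiv).trans toDelta
  continuous_toFun := e.continuous.continuousGeneratedBy.continuousMap.continuous
  continuous_invFun := e.symm.continuous.continuousGeneratedBy.continuousMap.continuous

/-- The product of `Δ`-generated spaces is the `Δ`-kelleyfication of the product. -/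
def deltaProdHomeomorph (X Y : Type*) [TopologicalSpace X] [TopologicalSpace Y] :
    DeltaProd (DeltaKelley X) (DeltaKelley Y) ≃ₜ DeltaKelley (X × Y) where
  toEquiv := (ofDelta.trans (ofDelta.prodCongr ofDelta)).trans toDelta
  continuous_toFun := (WithGeneratedByTopology.continuous_equiv.prodMap
    WithGeneratedByTopology.continuous_equiv).continuousGeneratedBy.continuousMap.continuous
  continuous_invFun := by
    -- A probe `ℝᵏ → X × Y` has two continuous components, and each of them stays continuous into
    -- the kelleyfication.
    refine (ContinuousGeneratedBy.continuousMap (g := Prod.map toDelta toDelta) ?_).continuous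
    intro k f
    exact ((IsGeneratedBy.equiv_symm_comp_continuous_iff _ _).2
      (continuous_fst.comp f.continuous)).prodMk
      ((IsGeneratedBy.equiv_symm_comp_continuous_iff _ _).2 (continuous_snd.comp f.continuous))

/-- A family of homeomorphisms induces a homeomorphism of the disjoint unions. -/
def Homeomorph.sigmaCongr {ι : Type*} {X Y : ι → Type*} [∀ i, TopologicalSpace (X i)]
    [∀ i, TopologicalSpace (Y i)] (e : ∀ i, X i ≃ₜ Y i) : (Σ i, X i) ≃ₜ Σ i, Y i where
  toEquiv := Equiv.sigmaCongrRight fun i => (e i).toEquiv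
  continuous_toFun := continuous_sigma fun i => continuous_sigmaMk.comp (e i).continuous
  continuous_invFun := continuous_sigma fun i => continuous_sigmaMk.comp (e i).symm.continuous

namespace PrecubicalSet

variable {K : PrecubicalSet.{u}}

/-- The space of tame paths is the disjoint union of its subspaces of paths of given arc
length. -/
def sigmaArcLengthHomeomorph (α β : K.cells 0) {ℓ : ℝ} (hℓ : 0 < ℓ) :
    (Σ n : {n : ℕ // 1 ≤ n}, K.PLenSpace α β hℓ n) ≃ₜ K.PSpace α β ℓ where
  toEquiv := ((Equiv.sigmaCongrRight fun _ => ofDelta).trans (sigmaArcLengthEquiv α β hℓ)).trans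
    toDelta
  continuous_toFun := continuous_sigma fun n =>
    (continuous_inclusion (fun _ h => h.1 : K.tamePathsOfArcLength α β hℓ n ⊆
      K.tamePaths α β ℓ)).continuousGeneratedBy.continuousMap.continuous
  continuous_invFun := by
    refine (WithGeneratedByTopology.continuous_from_iff _).2 fun k f => ?_
    let F : (Fin k → ℝ) → Σ n : {n : ℕ // 1 ≤ n}, K.tamePathsOfArcLength α β hℓ n :=
      fun x => (sigmaArcLengthEquiv α β hℓ).symm (f x)
    -- `ℝᵏ` is connected and the index set is discrete, so the whole probe lies in the summand
    -- containing its value at the origin.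
    have hconst : ∀ x, (F x).1 = (F 0).1 := fun x => PreconnectedSpace.constant inferInstance
      ((continuous_sigmaArcLengthEquiv_symm_fst α β hℓ).comp f.continuous)
    have hmem : ∀ x, (f x).1 ∈ K.tamePathsOfArcLength α β hℓ (F 0).1 := fun x => by
      rw [← hconst x]
      exact (F x).2.2
    have hcont : Continuous fun x =>
        (⟨(f x).1, hmem x⟩ : K.tamePathsOfArcLength α β hℓ (F 0).1) := by fun_prop
    have hmk : Continuous fun q : K.PLenSpace α β hℓ (F 0).1 =>
        (⟨(F 0).1, q⟩ : Σ n : {n : ℕ // 1 ≤ n}, K.PLenSpace α β hℓ n) :=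
      @continuous_sigmaMk _ (fun n : {n : ℕ // 1 ≤ n} => K.PLenSpace α β hℓ n) _ _
    refine (hmk.comp
      ((IsGeneratedBy.equiv_symm_comp_continuous_iff _ _).2 hcont)).congr fun x => ?_
    have : (⟨(F 0).1, (f x).1, hmem x⟩ :
        Σ n : {n : ℕ // 1 ≤ n}, K.tamePathsOfArcLength α β hℓ n) = F x := by
      rw [← Equiv.apply_eq_iff_eq (sigmaArcLengthEquiv α β hℓ)]
      exact ((sigmaArcLengthEquiv α β hℓ).apply_symm_apply (f x)).symm
    exact congrArg (Equiv.sigmaCongrRight fun n : {n : ℕ // 1 ≤ n} =>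
      (toDelta : K.tamePathsOfArcLength α β hℓ n ≃ _)) this

/-- The homeomorphism `(φ, γ) ↦ γ φ` from the product with the space of natural paths. -/
def naturalDeltaHomeomorph (α β : K.cells 0) {ℓ : ℝ} (hℓ : 0 < ℓ) {n : ℕ} (hn : 1 ≤ n) :
    DeltaProd (MSpace ℓ n) (K.NSpace α β n) ≃ₜ K.PLenSpace α β hℓ n :=
  (deltaProdHomeomorph _ _).trans (naturalHomeomorph α β hℓ hn).deltaKelley

/-- The continuous map `(φ, γ) ↦ γ φ`. -/
def compReparam (α β : K.cells 0) {ℓ ℓ' : ℝ} (hℓ : 0 < ℓ) (hℓ' : 0 < ℓ') :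
    C(Reparam ℓ ℓ' × K.tamePaths α β ℓ', K.tamePaths α β ℓ) where
  toFun x := ⟨x.2.1.comp x.1.1, comp_reparam_mem_tamePaths hℓ hℓ' x.2.2 x.1⟩
  continuous_toFun := Continuous.subtype_mk (ContinuousMap.continuous_comp'.comp
    ((continuous_subtype_val.comp continuous_fst).prodMk
      (continuous_subtype_val.comp continuous_snd))) _

end PrecubicalSet

end

theorem mainTheorem3 (K : PrecubicalSet.{u}) (α β : K.cells 0) {ℓ : ℝ} (hℓ : 0 < ℓ) :
    (∀ n : ℕ, 1 ≤ n →
      (∃ Φ : C(DeltaProd (MSpace ℓ n) (K.PSpace α β n), K.PSpace α β ℓ),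
        ∀ (φ : Reparam ℓ n) (γ : K.tamePaths α β n),
          (ofDelta (Φ (toDelta (toDelta φ, toDelta γ)))).1 = γ.1.comp φ.1) ∧
      (∃ Φ : DeltaProd (MSpace ℓ n) (K.NSpace α β n) ≃ₜ K.PLenSpace α β hℓ n,
        ∀ (φ : Reparam ℓ n) (γ : K.naturalPaths α β n),
          (ofDelta (Φ (toDelta (toDelta φ, toDelta γ)))).1 = γ.1.comp φ.1)) ∧
    (∃ Φ : (Σ n : {n : ℕ // 1 ≤ n}, DeltaProd (MSpace ℓ n) (K.NSpace α β n)) ≃ₜ K.PSpace α β ℓ,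
      ∀ (n : {n : ℕ // 1 ≤ n}) (φ : Reparam ℓ n) (γ : K.naturalPaths α β n),
        (ofDelta (Φ ⟨n, toDelta (toDelta φ, toDelta γ)⟩)).1 = γ.1.comp φ.1) := by
  refine ⟨fun n hn => ⟨?_, PrecubicalSet.naturalDeltaHomeomorph α β hℓ hn, fun _ _ => rfl⟩, ?_⟩
  · exact ⟨(PrecubicalSet.compReparam α β hℓ
      (Nat.cast_pos.2 hn)).continuous.continuousGeneratedBy.continuousMap.comp
        ⟨_, (deltaProdHomeomorph _ _).continuous⟩, fun _ _ => rfl⟩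
  · exact ⟨(Homeomorph.sigmaCongr fun n : {n : ℕ // 1 ≤ n} =>
      PrecubicalSet.naturalDeltaHomeomorph α β hℓ n.2).trans
        (PrecubicalSet.sigmaArcLengthHomeomorph α β hℓ), fun _ _ _ => rfl⟩
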